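/- Let $\mathbb N^+$ denote the set of positive integers. Call $d\in\mathbb N^+$ a *unitary divisor* of $n\in\mathbb N^+$ if $n=dm$ for some $m$ with $\gcd(d,m)=1$; this is a partial order on $\mathbb N^+$. Let $V\subseteq\mathbb N^+$ be a finite order ideal for this order (i.e. $V$ contains every unitary divisor of each of its elements) with at least two elements. Let $\mathcal A_V$ be the commutative $\mathbb C$-algebra of all functions $f:\mathbb N^+\to\mathbb C$ supported in $V$, with pointwise addition and scalar multiplication and with the truncated unitary convolution $$(f\oplus_V g)(n)=\sum_{dm=n,\ \gcd(d,m)=1} f(d)\,g(m)\quad (n\in V),\qquad (f\oplus_V g)(n)=0\quad (n\notin V).$$ For $n\in V$ let $e_n\in\mathcal A_V$ be the function with value $1$ at $n$ and $0$ elsewhere. The algebra $\mathcal A_V$ is a local ring; its socle $\operatorname{Socle}(\mathcal A_V)$ is the set of elements of the maximal ideal that annihilate the maximal ideal. A Noetherian local ring is called Gorenstein if it has finite injective dimension as a module over itself. Let $P$ be the set of prime powers $p^a$ ($p$ prime, $a\ge 1$) contained in $V$, and let $\Delta(V)$ be the simplicial complex on the vertex set $P$ whose faces are the sets $\{q_1^{a_1},\dots,q_s^{a_s}\}\subseteq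 P$ of powers of pairwise distinct primes $q_1,\dots,q_s$ ($s\ge 0$) such that $q_1^{a_1}\cdots q_s^{a_s}\in V$. Let $k=\max V$. Then $e_k\in\operatorname{Socle}(\mathcal A_V)$, and the following are equivalent: 1. $\mathcal A_V$ is Gorenstein; 2. $\operatorname{Socle}(\mathcal A_V)=\mathbb C e_k$; 3. for every $j\in V\setminus\{k,1\}$ there is at least one $i\in V\setminus\{k,1\}$ such that $\gcd(i,j)=1$ and $ij\in V$; 4. $V$ is a principal order ideal, i.e. $V$ is the set of all unitary divisors of some $n\in\mathbb N^+$; 5. $\Delta(V)$ is a simplex, i.e. every subset of $P$ is a face of $\Delta(V)$. -/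

import Mathlib

namespace UnitaryConv

/-- `d` is a unitary divisor of `n`: `n = d * m` for some `m` coprime to `d`. -/
def UnitaryDvd (d n : ℕ) : Prop := ∃ m : ℕ, Nat.Coprime d m ∧ d * m = n

/-- Non-empty order ideals of the positive integers ordered by unitary divisibility. -/
structure OrderIdeal where
  /-- the underlying set of positive integers -/
  carrier : Set ℕ
  pos : ∀ n ∈ carrier, 0 < n
  nonempty : carrier.Nonempty
  mem_of_unitaryDvd : ∀ n ∈ carrier, ∀ d : ℕ, UnitaryDvd d n → d ∈ carrier

/-- `V` is the principal order ideal generated by some positive integer. -/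
def OrderIdeal.IsPrincipal (V : OrderIdeal) : Prop :=
  ∃ n : ℕ, 0 < n ∧ V.carrier = {d : ℕ | UnitaryDvd d n}

theorem OrderIdeal.one_mem (V : OrderIdeal) : 1 ∈ V.carrier := by
  obtain ⟨n, hn⟩ := V.nonempty
  exact V.mem_of_unitaryDvd n hn 1 ⟨n, by simp, by simp⟩

theorem OrderIdeal.left_mem (V : OrderIdeal) {a b : ℕ} (h : a * b ∈ V.carrier)
    (hc : Nat.Coprime a b) : a ∈ V.carrier :=
  V.mem_of_unitaryDvd _ h a ⟨b, hc, rfl⟩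

theorem OrderIdeal.right_mem (V : OrderIdeal) {a b : ℕ} (h : a * b ∈ V.carrier)
    (hc : Nat.Coprime a b) : b ∈ V.carrier :=
  V.mem_of_unitaryDvd _ h b ⟨a, hc.symm, Nat.mul_comm b a⟩

/-! ### Unitary convolution and its truncations -/

/-- The pairs `(a, b)` of coprime positive integers with `a * b = n` (for `n > 0`). -/
def unitaryPairs (n : ℕ) : Finset (ℕ × ℕ) :=
  n.divisorsAntidiagonal.filter fun x => Nat.Coprime x.1 x.2

theorem mem_unitaryPairs {n : ℕ} {x : ℕ × ℕ} :
    x ∈ unitaryPairs n ↔ (x.1 * x.2 = n ∧ n ≠ 0) ∧ Nat.Coprime x.1 x.2 := by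
  simp [unitaryPairs, Nat.mem_divisorsAntidiagonal]

/-- Unitary convolution of arithmetical functions. -/
noncomputable def conv (f g : ℕ → ℂ) (n : ℕ) : ℂ :=
  ∑ x ∈ unitaryPairs n, f x.1 * g x.2

theorem conv_comm (f g : ℕ → ℂ) : conv f g = conv g f := by
  funext n
  unfold conv
  refine Finset.sum_nbij' Prod.swap Prod.swap ?_ ?_ ?_ ?_ ?_
  · intro x hx
    rw [mem_unitaryPairs] at hx ⊢
    exact ⟨⟨by rw [← hx.1.1]; exact Nat.mul_comm _ _, hx.1.2⟩, hx.2.symm⟩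
  · intro x hx
    rw [mem_unitaryPairs] at hx ⊢
    exact ⟨⟨by rw [← hx.1.1]; exact Nat.mul_comm _ _, hx.1.2⟩, hx.2.symm⟩
  · intro x _; rfl
  · intro x _; rfl
  · intro x _; exact mul_comm _ _

theorem conv_assoc (f g h : ℕ → ℂ) : conv (conv f g) h = conv f (conv g h) := by
  funext n
  unfold conv
  simp only [Finset.sum_mul, Finset.mul_sum, Finset.sum_sigma']
  refine Finset.sum_nbij'
    (fun ⟨⟨_, j⟩, ⟨k, l⟩⟩ => ⟨(k, l * j), (l, j)⟩)
    (fun ⟨⟨i, _⟩, ⟨k, l⟩⟩ => ⟨(i * k, l), (i, k)⟩) ?_ ?_ ?_ ?_ ?_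
  · rintro ⟨⟨i, j⟩, ⟨k, l⟩⟩ hx
    simp only [Finset.mem_sigma, mem_unitaryPairs] at hx ⊢
    obtain ⟨⟨⟨h1, h2⟩, h3⟩, ⟨⟨h4, h5⟩, h6⟩⟩ := hx
    subst h4
    rw [Nat.coprime_mul_iff_left] at h3
    refine ⟨⟨⟨by rw [← h1, Nat.mul_assoc], h2⟩, Nat.coprime_mul_iff_right.2 ⟨h6, h3.1⟩⟩,
      ⟨⟨trivial, ?_⟩, h3.2⟩⟩
    rintro h0
    apply h2
    rw [← h1, Nat.mul_assoc, h0, Nat.mul_zero]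
  · rintro ⟨⟨i, j⟩, ⟨k, l⟩⟩ hx
    simp only [Finset.mem_sigma, mem_unitaryPairs] at hx ⊢
    obtain ⟨⟨⟨h1, h2⟩, h3⟩, ⟨⟨h4, h5⟩, h6⟩⟩ := hx
    subst h4
    rw [Nat.coprime_mul_iff_right] at h3
    refine ⟨⟨⟨by rw [← h1, Nat.mul_assoc], h2⟩, Nat.coprime_mul_iff_left.2 ⟨h3.2, h6⟩⟩,
      ⟨⟨trivial, ?_⟩, h3.1⟩⟩
    rintro h0
    apply h2
    rw [← h1, ← Nat.mul_assoc, h0, Nat.zero_mul]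
  · rintro ⟨⟨i, j⟩, ⟨k, l⟩⟩ hx
    simp only [Finset.mem_sigma, mem_unitaryPairs] at hx
    obtain ⟨_, ⟨⟨h4, _⟩, _⟩⟩ := hx
    subst h4
    rfl
  · rintro ⟨⟨i, j⟩, ⟨k, l⟩⟩ hx
    simp only [Finset.mem_sigma, mem_unitaryPairs] at hx
    obtain ⟨_, ⟨⟨h4, _⟩, _⟩⟩ := hx
    subst h4
    rfl
  · rintro ⟨⟨i, j⟩, ⟨k, l⟩⟩ _
    exact mul_assoc _ _ _

theorem one_conv (f : ℕ → ℂ) {n : ℕ} (hn : n ≠ 0) : conv (Pi.single 1 1) f n = f n := by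
  unfold conv
  rw [Finset.sum_eq_single (1, n)]
  · simp
  · rintro ⟨a, b⟩ hx hne
    rw [mem_unitaryPairs] at hx
    have ha : a ≠ 1 := by
      rintro rfl
      apply hne
      rw [← hx.1.1, Nat.one_mul]
    simp [ha]
  · intro h
    exact absurd (mem_unitaryPairs.2 ⟨⟨Nat.one_mul n, hn⟩, by simp⟩) h

theorem conv_add (f g h : ℕ → ℂ) : conv f (g + h) = conv f g + conv f h := by
  funext n
  simp [conv, mul_add, Finset.sum_add_distrib]

theorem conv_smul (c : ℂ) (f g : ℕ → ℂ) : conv f (c • g) = c • conv f g := by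
  funext n
  simp only [conv, Pi.smul_apply, smul_eq_mul, Finset.mul_sum]
  exact Finset.sum_congr rfl fun _ _ => mul_left_comm _ _ _

/-- The values of a convolution on an order ideal depend only on the values there. -/
theorem conv_congr (V : OrderIdeal) {f f' g g' : ℕ → ℂ} (hf : ∀ n ∈ V.carrier, f n = f' n)
    (hg : ∀ n ∈ V.carrier, g n = g' n) {n : ℕ} (hn : n ∈ V.carrier) :
    conv f g n = conv f' g' n := by
  unfold conv
  refine Finset.sum_congr rfl fun x hx => ?_
  rw [mem_unitaryPairs] at hx
  rw [← hx.1.1] at hn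
  rw [hf _ (V.left_mem hn hx.2), hg _ (V.right_mem hn hx.2)]

/-- The vector space of arithmetical functions supported in `V`. -/
def truncSubmodule (V : OrderIdeal) : Submodule ℂ (ℕ → ℂ) where
  carrier := {f | Function.support f ⊆ V.carrier}
  zero_mem' := by simp
  add_mem' := by
    intro f g hf hg
    exact (Function.support_add f g).trans (Set.union_subset hf hg)
  smul_mem' := by
    intro c f hf
    exact (Function.support_const_smul_subset c f).trans hf

/-- The truncated algebra of arithmetical functions supported in `V`. -/
def TruncAlgebra (V : OrderIdeal) : Type := truncSubmodule V

namespace TruncAlgebra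

variable {V : OrderIdeal}

instance : AddCommGroup (TruncAlgebra V) := inferInstanceAs (AddCommGroup (truncSubmodule V))

instance : Module ℂ (TruncAlgebra V) := inferInstanceAs (Module ℂ (truncSubmodule V))

/-- The underlying arithmetical function. -/
def toFun (f : TruncAlgebra V) : ℕ → ℂ := f.1

theorem toFun_eq_zero (f : TruncAlgebra V) {n : ℕ} (hn : n ∉ V.carrier) : f.toFun n = 0 := by
  by_contra h
  exact hn (f.2 h)

theorem toFun_add (f g : TruncAlgebra V) : (f + g).toFun = f.toFun + g.toFun := rfl

theorem toFun_smul (c : ℂ) (f : TruncAlgebra V) : (c • f).toFun = c • f.toFun := rfl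

theorem toFun_zero : (0 : TruncAlgebra V).toFun = 0 := rfl

theorem ext {f g : TruncAlgebra V} (h : ∀ n ∈ V.carrier, f.toFun n = g.toFun n) : f = g := by
  refine Subtype.ext (funext fun n => ?_)
  by_cases hn : n ∈ V.carrier
  · exact h n hn
  · exact (f.toFun_eq_zero hn).trans (g.toFun_eq_zero hn).symm

/-- The truncation map: restrict an arithmetical function to `V`, extended by zero. -/
noncomputable def trunc (V : OrderIdeal) (f : ℕ → ℂ) : TruncAlgebra V :=
  ⟨V.carrier.indicator f, Set.support_indicator_subset⟩

theorem toFun_trunc (f : ℕ → ℂ) {n : ℕ} (hn : n ∈ V.carrier) : (trunc V f).toFun n = f n :=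
  Set.indicator_of_mem hn f

/-- The basis element `e_k` (zero if `k` is not in `V`). -/
noncomputable def e (V : OrderIdeal) (k : ℕ) : TruncAlgebra V := trunc V (Pi.single k 1)

/-- The product is the unitary convolution, truncated to `V`. -/
noncomputable instance : Mul (TruncAlgebra V) := ⟨fun f g => trunc V (conv f.toFun g.toFun)⟩

/-- The unit is `e_1`. -/
noncomputable instance : One (TruncAlgebra V) := ⟨e V 1⟩

theorem toFun_mul (f g : TruncAlgebra V) {n : ℕ} (hn : n ∈ V.carrier) :
    (f * g).toFun n = conv f.toFun g.toFun n := toFun_trunc _ hn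

theorem toFun_one {n : ℕ} (hn : n ∈ V.carrier) :
    (1 : TruncAlgebra V).toFun n = (Pi.single 1 1 : ℕ → ℂ) n := toFun_trunc _ hn

protected theorem mul_comm (f g : TruncAlgebra V) : f * g = g * f :=
  ext fun n hn => by rw [toFun_mul _ _ hn, toFun_mul _ _ hn, conv_comm]

protected theorem one_mul (f : TruncAlgebra V) : 1 * f = f :=
  ext fun n hn => by
    rw [toFun_mul _ _ hn, conv_congr V (fun m hm => toFun_one hm) (fun _ _ => rfl) hn,
      one_conv _ (V.pos n hn).ne']

protected theorem mul_assoc (f g h : TruncAlgebra V) : f * g * h = f * (g * h) :=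
  ext fun n hn => by
    rw [toFun_mul _ _ hn, toFun_mul _ _ hn,
      conv_congr V (fun m hm => toFun_mul f g hm) (fun _ _ => rfl) hn,
      conv_congr V (fun _ _ => rfl) (fun m hm => toFun_mul g h hm) hn, conv_assoc]

protected theorem mul_add (f g h : TruncAlgebra V) : f * (g + h) = f * g + f * h :=
  ext fun n hn => by
    rw [toFun_mul _ _ hn, toFun_add, toFun_add, conv_add, Pi.add_apply, Pi.add_apply,
      toFun_mul _ _ hn, toFun_mul _ _ hn]

protected theorem mul_smul (c : ℂ) (f g : TruncAlgebra V) : f * (c • g) = c • (f * g) :=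
  ext fun n hn => by
    rw [toFun_mul _ _ hn, toFun_smul, toFun_smul, conv_smul, Pi.smul_apply, Pi.smul_apply,
      toFun_mul _ _ hn]

protected theorem mul_zero (f : TruncAlgebra V) : f * 0 = 0 :=
  ext fun n hn => by
    rw [toFun_mul _ _ hn, toFun_zero]
    simp [conv]

noncomputable instance : CommRing (TruncAlgebra V) :=
  { (inferInstance : AddCommGroup (TruncAlgebra V)) with
    mul := (· * ·)
    one := 1
    mul_comm := TruncAlgebra.mul_comm
    mul_assoc := TruncAlgebra.mul_assoc
    one_mul := TruncAlgebra.one_mul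
    mul_one := fun f => by rw [TruncAlgebra.mul_comm, TruncAlgebra.one_mul]
    left_distrib := TruncAlgebra.mul_add
    right_distrib := fun f g h => by
      rw [TruncAlgebra.mul_comm, TruncAlgebra.mul_add, TruncAlgebra.mul_comm h f,
        TruncAlgebra.mul_comm h g]
    zero_mul := fun f => by rw [TruncAlgebra.mul_comm, TruncAlgebra.mul_zero]
    mul_zero := TruncAlgebra.mul_zero }

noncomputable instance : Algebra ℂ (TruncAlgebra V) :=
  Algebra.ofModule
    (fun c f g => by rw [mul_comm (c • f) g, TruncAlgebra.mul_smul, mul_comm g f])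
    (fun c f g => TruncAlgebra.mul_smul c f g)

/-! The algebra is local: an element is a unit as soon as its value at `1` is nonzero. -/

theorem conv_eq_add (f g : ℕ → ℂ) {n : ℕ} (hn : n ≠ 0) :
    conv f g n = f 1 * g n + ∑ x ∈ (unitaryPairs n).erase (1, n), f x.1 * g x.2 := by
  unfold conv
  rw [← Finset.add_sum_erase _ _
    (mem_unitaryPairs.2 ⟨⟨Nat.one_mul n, hn⟩, by simp⟩ : ((1, n) : ℕ × ℕ) ∈ unitaryPairs n)]

theorem snd_lt {n : ℕ} {x : ℕ × ℕ} (hx : x ∈ (unitaryPairs n).erase (1, n)) : x.2 < n := by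
  obtain ⟨a, b⟩ := x
  rw [Finset.mem_erase, mem_unitaryPairs] at hx
  obtain ⟨h1, ⟨⟨h2, h3⟩, _⟩⟩ := hx
  dsimp only at h2 ⊢
  have ha : a ≠ 1 := by
    rintro rfl
    exact h1 (by rw [← h2, Nat.one_mul])
  have ha0 : a ≠ 0 := by
    rintro rfl
    exact h3 (by rw [← h2, Nat.zero_mul])
  have hb0 : 0 < b := by
    rcases Nat.eq_zero_or_pos b with rfl | h
    · exact absurd (by rw [← h2, Nat.mul_zero]) h3
    · exact h
  have : 2 ≤ a := by omega
  nlinarith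

/-- The inverse of `f` for unitary convolution, computed recursively. -/
noncomputable def inv (f : ℕ → ℂ) (n : ℕ) : ℂ :=
  (f 1)⁻¹ * ((Pi.single 1 1 : ℕ → ℂ) n -
    ∑ x ∈ ((unitaryPairs n).erase (1, n)).attach, f x.1.1 * inv f x.1.2)
termination_by n
decreasing_by exact snd_lt x.2

theorem conv_inv (f : ℕ → ℂ) (hf : f 1 ≠ 0) {n : ℕ} (hn : n ≠ 0) :
    conv f (inv f) n = (Pi.single 1 1 : ℕ → ℂ) n := by
  rw [conv_eq_add _ _ hn]
  conv_lhs => enter [1, 2]; rw [inv]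
  rw [mul_inv_cancel_left₀ hf,
    Finset.sum_attach ((unitaryPairs n).erase (1, n)) fun x => f x.1 * inv f x.2]
  ring

theorem isUnit_of_ne_zero (f : TruncAlgebra V) (hf : f.toFun 1 ≠ 0) : IsUnit f := by
  refine IsUnit.of_mul_eq_one (trunc V (inv f.toFun)) (ext fun n hn => ?_)
  rw [toFun_mul _ _ hn, conv_congr V (fun _ _ => rfl) (fun m hm => toFun_trunc _ hm) hn,
    conv_inv _ hf (V.pos n hn).ne', toFun_one hn]

instance : Nontrivial (TruncAlgebra V) := by
  refine ⟨⟨1, 0, fun h => ?_⟩⟩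
  have h1 := toFun_one (V := V) V.one_mem
  rw [h, toFun_zero] at h1
  simp at h1

instance : IsLocalRing (TruncAlgebra V) := by
  refine IsLocalRing.of_isUnit_or_isUnit_one_sub_self fun a => ?_
  by_cases ha : a.toFun 1 = 0
  · right
    apply isUnit_of_ne_zero
    intro hb
    have h1 := toFun_one (V := V) V.one_mem
    rw [← sub_add_cancel 1 a, toFun_add, Pi.add_apply, ha, hb] at h1
    simp at h1
  · left
    exact isUnit_of_ne_zero a ha

end TruncAlgebra

/-! ### Socle and the Gorenstein property -/

/-- The socle of a local ring: all elements of the maximal ideal that annihilate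
the maximal ideal. -/
def socle (R : Type*) [CommRing R] [IsLocalRing R] : Ideal R where
  carrier := {f | f ∈ IsLocalRing.maximalIdeal R ∧ ∀ g ∈ IsLocalRing.maximalIdeal R, f * g = 0}
  zero_mem' := ⟨Ideal.zero_mem _, fun g _ => zero_mul g⟩
  add_mem' := fun {a b} ha hb =>
    ⟨Ideal.add_mem _ ha.1 hb.1, fun g hg => by rw [add_mul, ha.2 g hg, hb.2 g hg, add_zero]⟩
  smul_mem' := fun c a ha =>
    ⟨Ideal.mul_mem_left _ c ha.1, fun g hg => by
      rw [smul_eq_mul, mul_assoc, ha.2 g hg, mul_zero]⟩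

/-- A Gorenstein local ring: a Noetherian local ring which has finite injective dimension as a
module over itself. -/
structure IsGorensteinLocalRing (R : Type*) [CommRing R] : Prop where
  isNoetherianRing : IsNoetherianRing R
  isLocalRing : IsLocalRing R
  finite_injectiveDimension :
    ∃ n : ℕ, CategoryTheory.HasInjectiveDimensionLT (ModuleCat.of R R) n

/-! ### The associated partitioned simplicial complex -/

/-- A partitioned simplicial complex on the vertex set `S`, where `S` is partitioned into the
non-empty fibres of `part`: a family of finite subsets of `S`, each meeting every block of the
partition in at most one point, closed under passing to subsets and containing all singletons. -/
structure PartitionedComplex {α β : Type*} (S : Set α) (part : α → β) where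
  /-- the faces, the empty set included -/
  faces : Set (Finset α)
  subset_of_mem : ∀ σ ∈ faces, (σ : Set α) ⊆ S
  injOn_of_mem : ∀ σ ∈ faces, Set.InjOn part (σ : Set α)
  singleton_mem : ∀ s ∈ S, {s} ∈ faces
  down_closed : ∀ σ ∈ faces, ∀ τ : Finset α, τ ⊆ σ → τ ∈ faces

/-- The complex is a simplex: every finite set of vertices is a face. -/
def PartitionedComplex.IsSimplex {α β : Type*} {S : Set α} {part : α → β}
    (Δ : PartitionedComplex S part) : Prop :=
  Δ.faces = {σ : Finset α | (σ : Set α) ⊆ S}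

/-- The prime powers `p ^ a` (with `a ≥ 1`) in `V`. -/
def OrderIdeal.primePowers (V : OrderIdeal) : Set ℕ := {q | q ∈ V.carrier ∧ IsPrimePow q}

theorem coprime_of_minFac_ne {a b : ℕ} (ha : IsPrimePow a) (hb : IsPrimePow b)
    (h : a.minFac ≠ b.minFac) : Nat.Coprime a b := by
  rw [← ha.minFac_pow_factorization_eq, ← hb.minFac_pow_factorization_eq]
  exact ((Nat.coprime_primes (Nat.minFac_prime ha.ne_one) (Nat.minFac_prime hb.ne_one)).2 h).pow _ _

/-- The complex `Δ(V)` on the prime powers in `V`, partitioned according to their prime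
(the least prime factor): a set of powers of distinct primes is a face if and only if its product
lies in `V`. -/
def complex (V : OrderIdeal) : PartitionedComplex V.primePowers Nat.minFac where
  faces := {σ | (σ : Set ℕ) ⊆ V.primePowers ∧ Set.InjOn Nat.minFac (σ : Set ℕ) ∧
    ∏ q ∈ σ, q ∈ V.carrier}
  subset_of_mem := fun _ h => h.1
  injOn_of_mem := fun _ h => h.2.1
  singleton_mem := fun s hs => ⟨by simpa using hs, by simp, by simpa using hs.1⟩
  down_closed := by
    classical
    intro σ hσ τ hτ
    have hτ' : (τ : Set ℕ) ⊆ σ := Finset.coe_subset.2 hτ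
    refine ⟨hτ'.trans hσ.1, hσ.2.1.mono hτ', ?_⟩
    have hprod := hσ.2.2
    rw [← Finset.prod_sdiff hτ] at hprod
    refine V.right_mem hprod ?_
    refine Nat.Coprime.prod_left fun a ha => Nat.Coprime.prod_right fun b hb => ?_
    have ha' := Finset.mem_sdiff.1 ha
    refine coprime_of_minFac_ne (hσ.1 ha'.1).2 (hσ.1 (hτ hb)).2 fun hab => ?_
    have := hσ.2.1 ha'.1 (hτ hb) hab
    exact ha'.2 (this ▸ hb)

end UnitaryConv

/-! The plan is 1 → 2 → 3 → 4 → 1 together with 4 ↔ 5. 1 → 2: the maximal ideal is nilpotent and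
`e_k` is a non-zero socle element, so finite injective dimension forces self-injectivity
(`injective_of_hasInjectiveDimensionLT`). Over a self-injective local ring any two non-zero socle
elements are multiples of each other, and on the socle the algebra acts through its residue field
`ℂ`. 2 → 3: an element `j ≠ 1` maximal in `V` for unitary divisibility gives a socle element `e_j`,
so `k` is the only such `j`. 3 → 4: climbing through unitary multiples from any element of `V` ends
at `k`. 4 → 1: the form `f ↦ f k` has no non-zero ideal in its kernel, which makes the algebra
self-injective (`Module.Injective.self_of_linearForm`). 4 ↔ 5: a number is the product of its
primary components, so the generator of a principal `V` is the product of all vertices of `Δ(V)`. -/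

/-! ### Injective dimension over a local ring with nilpotent maximal ideal -/

-- Dimension shifting: `Ext N X (d + 1)` sits between the same degree for `F`, zero by projectivity,
-- and degree `d + 2` for the cokernel, zero by the bound on `X`.
open CategoryTheory Abelian in
theorem CategoryTheory.Abelian.Ext.eq_zero_of_mono_projective {C : Type*} [Category C] [Abelian C]
    [HasExt C] {N F X : C} {d : ℕ} (f : N ⟶ F) [Mono f] [Projective F]
    [HasInjectiveDimensionLT X (d + 2)] (x : Ext N X (d + 1)) : x = 0 := by
  have hS : (ShortComplex.mk f (Limits.cokernel.π f) (by simp)).ShortExact :=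
    { exact := ShortComplex.exact_cokernel f }
  obtain ⟨y, rfl⟩ := Ext.contravariant_sequence_exact₁ hS X x (Nat.add_comm 1 (d + 1))
    (Ext.eq_zero_of_hasInjectiveDimensionLT _ (d + 2) le_rfl)
  rw [Ext.eq_zero_of_projective y, Ext.comp_zero]

open CategoryTheory Abelian in
theorem CategoryTheory.ShortComplex.ShortExact.ext_eq_zero {C : Type*} [Category C] [Abelian C]
    [HasExt C] {S : ShortComplex C} (hS : S.ShortExact) {X : C} {n : ℕ}
    (h₁ : ∀ x : Ext S.X₁ X n, x = 0) (h₃ : ∀ x : Ext S.X₃ X n, x = 0) (x : Ext S.X₂ X n) :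
    x = 0 := by
  obtain ⟨y, rfl⟩ := Ext.contravariant_sequence_exact₂ hS X x (h₁ _)
  rw [h₃ y, Ext.comp_zero]

namespace IsLocalRing

universe u

variable {R : Type u} [CommRing R] [IsLocalRing R]

/-- A module killed by the maximal ideal embeds into a free module as soon as the ring has a
non-zero element killed by the maximal ideal. -/
theorem exists_injective_finsupp {s : R} (hs : s ≠ 0) (hms : ∀ a ∈ maximalIdeal R, a * s = 0)
    (N : Type u) [AddCommGroup N] [Module R N]
    (hN : Module.IsTorsionBySet R N (maximalIdeal R : Set R)) :
    ∃ (ι : Type u) (f : N →ₗ[R] ι →₀ R), Function.Injective f := by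
  let : Field (R ⧸ maximalIdeal R) := Ideal.Quotient.field _
  let : Module (R ⧸ maximalIdeal R) N := hN.module
  have : IsScalarTower R (R ⧸ maximalIdeal R) N := hN.isScalarTower
  let b := Module.Basis.ofVectorSpace (R ⧸ maximalIdeal R) N
  -- The annihilator of `s` is exactly the maximal ideal, so `1 ↦ s` embeds the residue field in
  -- `R`; `N` is a direct sum of copies of that field.
  let g : (R ⧸ maximalIdeal R) →ₗ[R] R := (maximalIdeal R).liftQ (LinearMap.toSpanSingleton R R s)
    fun a ha => by simpa using hms a ha
  have hg : Function.Injective g := by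
    rw [← LinearMap.ker_eq_bot, Submodule.ker_liftQ_eq_bot]
    intro a ha
    by_contra h
    rw [IsLocalRing.mem_maximalIdeal, mem_nonunits_iff, not_not] at h
    exact hs (by simpa [h.mul_right_eq_zero] using ha)
  refine ⟨_, (Finsupp.mapRange.linearMap g).comp (b.repr.toLinearMap.restrictScalars R), ?_⟩
  exact (Finsupp.mapRange_injective g (map_zero g) hg).comp b.repr.injective

-- Filter `N` by the powers of the maximal ideal: each layer is killed by that ideal, hence embeds
-- in a free module, and dimension shifting applies to it.
open CategoryTheory Abelian in
theorem ext_eq_zero_of_pow_smul_eq_zero {s : R} (hs : s ≠ 0)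
    (hms : ∀ a ∈ maximalIdeal R, a * s = 0) {X : ModuleCat.{u} R} {d : ℕ}
    [HasInjectiveDimensionLT X (d + 2)] (r : ℕ) (N : Type u) [AddCommGroup N] [Module R N]
    (hN : (maximalIdeal R) ^ r • (⊤ : Submodule R N) = ⊥)
    (x : Ext (ModuleCat.of R N) X (d + 1)) : x = 0 := by
  induction r generalizing N with
  | zero =>
    have : Subsingleton N := by
      rw [pow_zero, Ideal.one_eq_top, Submodule.top_smul] at hN
      exact (Submodule.subsingleton_iff R).1 (subsingleton_of_bot_eq_top hN.symm)
    exact Ext.eq_zero_of_projective x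
  | succ r ih =>
    let M : Submodule R N := maximalIdeal R • (⊤ : Submodule R N)
    have hS : (ModuleCat.shortComplexOfCompEqZero M.subtype M.mkQ (by ext; simp)).ShortExact :=
      ModuleCat.shortComplex_shortExact _ (LinearMap.exact_subtype_mkQ M) M.subtype_injective
        M.mkQ_surjective
    refine hS.ext_eq_zero (fun y => ih M ?_ y) (fun y => ?_) x
    · apply Submodule.map_injective_of_injective M.subtype_injective
      rw [Submodule.map_smul'', Submodule.map_top, Submodule.range_subtype, Submodule.map_bot,
        ← hN, pow_succ, Submodule.mul_smul]
    · obtain ⟨ι, f, hf⟩ := exists_injective_finsupp hs hms (N ⧸ M) (by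
        rintro y ⟨a, ha⟩
        obtain ⟨y, rfl⟩ := M.mkQ_surjective y
        rw [← map_smul]
        exact (Submodule.Quotient.mk_eq_zero M).2 (Submodule.smul_mem_smul ha trivial))
      have : Mono (ModuleCat.ofHom f) := (ModuleCat.mono_iff_injective _).2 hf
      exact Ext.eq_zero_of_mono_projective (ModuleCat.ofHom f) y

open CategoryTheory Abelian in
/-- Over a local ring with nilpotent maximal ideal, modules of finite injective dimension are
injective. -/
theorem injective_of_hasInjectiveDimensionLT {s : R} (hs : s ≠ 0)
    (hms : ∀ a ∈ maximalIdeal R, a * s = 0) (hnil : IsNilpotent (maximalIdeal R))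
    (X : ModuleCat.{u} R) (n : ℕ) [HasInjectiveDimensionLT X n] : Injective X := by
  obtain ⟨r, hr⟩ := hnil
  have step : ∀ d : ℕ, HasInjectiveDimensionLT X (d + 1) → HasInjectiveDimensionLT X 1 := by
    intro d
    induction d with
    | zero => exact id
    | succ d ih =>
      -- Only degree `d + 1` is new. Since the `r`-th power of the maximal ideal is zero, the
      -- filtration argument covers every module `Y`.
      refine fun h => ih ((hasInjectiveDimensionLT_iff X (d + 1)).2 fun i hi Y x => ?_)
      rcases hi.eq_or_lt with rfl | hi
      · exact ext_eq_zero_of_pow_smul_eq_zero hs hms r Y (by rw [hr]; simp) x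
      · exact Ext.eq_zero_of_hasInjectiveDimensionLT x (d + 2) hi
  -- Passing from `n` to `n + 1` includes the case `n = 0`, as `step` starts from a bound `d + 1`.
  exact injective_iff_hasInjectiveDimensionLT_one.2
    (step n (hasInjectiveDimensionLT_of_ge X n (n + 1) n.le_succ))

/-- In a self-injective local ring, every socle element is a multiple of any non-zero one. -/
theorem exists_mul_eq_of_injective (hR : Module.Injective R R) {s t : R} (hs : s ≠ 0)
    (ht : ∀ a ∈ maximalIdeal R, a * t = 0) : ∃ a : R, t = a * s := by
  have hker : LinearMap.ker (LinearMap.toSpanSingleton R R s) ≤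
      LinearMap.ker (LinearMap.toSpanSingleton R R t) := by
    intro a ha
    refine LinearMap.mem_ker.2 (ht a ?_)
    by_contra h
    rw [IsLocalRing.mem_maximalIdeal, mem_nonunits_iff, not_not] at h
    exact hs (by simpa [h.mul_right_eq_zero] using ha)
  -- Both maps live on `R ⧸ Ann s`: the embedding `1 ↦ s` and the map `1 ↦ t`. An extension `l`
  -- satisfies `l s = t`, so `t = l 1 * s`.
  obtain ⟨l, hl⟩ := hR.out
    ((LinearMap.ker (LinearMap.toSpanSingleton R R s)).liftQ (LinearMap.toSpanSingleton R R s) le_rfl)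
    (LinearMap.ker_eq_bot.1 (Submodule.ker_liftQ_eq_bot _ _ _ le_rfl))
    ((LinearMap.ker (LinearMap.toSpanSingleton R R s)).liftQ (LinearMap.toSpanSingleton R R t) hker)
  refine ⟨l 1, ?_⟩
  have h1 := hl (Submodule.Quotient.mk 1)
  simp only [Submodule.liftQ_apply, LinearMap.toSpanSingleton_apply, one_smul] at h1
  rw [← h1, mul_comm, ← smul_eq_mul, ← map_smul, smul_eq_mul, mul_one]

end IsLocalRing

/-! ### Self-injectivity from a nondegenerate linear form -/

/-- A finite-dimensional algebra over a field carrying a linear form whose kernel contains no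
non-zero ideal is self-injective. -/
theorem Module.Injective.self_of_linearForm {K R : Type} [Field K] [CommRing R] [Algebra K R]
    [FiniteDimensional K R] (φ : R →ₗ[K] K) (hφ : ∀ f : R, (∀ g, φ (g * f) = 0) → f = 0) :
    Module.Injective R R := by
  let B : R →ₗ[K] Module.Dual K R := (LinearMap.mul K R).compr₂ φ
  have hB : Function.Injective B := by
    refine (injective_iff_map_eq_zero B).2 fun f hf => hφ f fun g => ?_
    rw [mul_comm]
    exact LinearMap.congr_fun hf g
  have hBs : Function.Surjective B :=
    (LinearMap.injective_iff_surjective_of_finrank_eq_finrank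
      (Subspace.dual_finrank_eq (K := K) (V := R)).symm).1 hB
  -- Baer's criterion: extend `φ ∘ g` linearly to all of `R` and write the extension as `φ (a * ·)`.
  -- Then `φ` kills every multiple of the difference of `x * a` and `g x`, so the two agree.
  refine Module.Baer.injective fun I g => ?_
  obtain ⟨h, hh⟩ := LinearMap.exists_extend (p := I.restrictScalars K)
    (φ.comp (g.restrictScalars K : I →ₗ[K] R))
  obtain ⟨a, ha⟩ := hBs h
  refine ⟨LinearMap.toSpanSingleton R R a, fun x hx => ?_⟩
  rw [← sub_eq_zero]
  refine hφ _ fun r => ?_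
  have h1 : φ (a * (r * x)) = φ (g (r • ⟨x, hx⟩)) := by
    have h2 := LinearMap.congr_fun hh (⟨r * x, I.mul_mem_left r hx⟩ : I)
    rw [← ha] at h2
    exact h2
  rw [map_smul] at h1
  rw [mul_sub, map_sub, sub_eq_zero, LinearMap.toSpanSingleton_apply, smul_eq_mul, ← mul_assoc,
    mul_comm, h1, smul_eq_mul]

/-! ### Unitary divisors, primary components and the simplex condition -/

namespace UnitaryConv

theorem UnitaryDvd.dvd {d n : ℕ} (h : UnitaryDvd d n) : d ∣ n := by
  obtain ⟨m, _, rfl⟩ := h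
  exact dvd_mul_right _ _

theorem UnitaryDvd.trans {a b c : ℕ} (hab : UnitaryDvd a b) (hbc : UnitaryDvd b c) :
    UnitaryDvd a c := by
  obtain ⟨m, hm, rfl⟩ := hab
  obtain ⟨l, hl, rfl⟩ := hbc
  exact ⟨m * l, hm.mul_right (hl.coprime_dvd_left (dvd_mul_right _ _)), (mul_assoc _ _ _).symm⟩

theorem UnitaryDvd.mul_of_coprime {a b n : ℕ} (hn : n ≠ 0) (ha : UnitaryDvd a n)
    (hb : UnitaryDvd b n) (hab : Nat.Coprime a b) : UnitaryDvd (a * b) n := by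
  obtain ⟨m, hm, rfl⟩ := ha
  obtain ⟨l, hl, hbl⟩ := hb
  obtain ⟨c, rfl⟩ : b ∣ m := hab.symm.dvd_of_dvd_mul_left ⟨l, hbl.symm⟩
  refine ⟨c, ?_, mul_assoc _ _ _⟩
  refine (hm.coprime_dvd_right (dvd_mul_left _ _)).mul_left ?_
  have hb0 : 0 < b := Nat.pos_of_ne_zero (by rintro rfl; simp at hn)
  -- The cofactor of `b` in `n` is `a * c`, so `c` inherits coprimality to `b` from `l`.
  have : l = a * c := Nat.eq_of_mul_eq_mul_left hb0 (by rw [hbl]; ring)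
  exact hl.coprime_dvd_right (this ▸ dvd_mul_left _ _)

theorem UnitaryDvd.prod {n : ℕ} (hn : n ≠ 0) {σ : Finset ℕ} (hσ : ∀ q ∈ σ, UnitaryDvd q n)
    (hc : (σ : Set ℕ).Pairwise Nat.Coprime) : UnitaryDvd (∏ q ∈ σ, q) n := by
  classical
  induction σ using Finset.induction_on with
  | empty => exact ⟨n, by simp, by simp⟩
  | insert a σ ha ih =>
    rw [Finset.prod_insert ha]
    refine UnitaryDvd.mul_of_coprime hn (hσ a (Finset.mem_insert_self _ _))
      (ih (fun q hq => hσ q (Finset.mem_insert_of_mem hq)) (hc.mono (by simp)))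
      (Nat.Coprime.prod_right fun b hb => hc (by simp) (by simp [hb]) ?_)
    rintro rfl
    exact ha hb

/-- Unitary prime power divisors of the same number at the same prime agree. -/
theorem UnitaryDvd.eq_of_minFac_eq {a b n : ℕ} (hn : 0 < n) (ha : UnitaryDvd a n)
    (hb : UnitaryDvd b n) (ha' : IsPrimePow a) (hb' : IsPrimePow b) (h : a.minFac = b.minFac) :
    a = b := by
  -- A prime power dividing `n` unitarily is the full `p`-part of `n`.
  have key : ∀ {c : ℕ}, UnitaryDvd c n → IsPrimePow c →
      c = c.minFac ^ n.factorization c.minFac := by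
    rintro c ⟨m, hm, rfl⟩ hc
    have hp := Nat.minFac_prime hc.ne_one
    rw [Nat.factorization_eq_of_coprime_left hm
      (Nat.mem_primeFactorsList hc.ne_zero |>.2 ⟨hp, c.minFac_dvd⟩)]
    exact hc.minFac_pow_factorization_eq.symm
  rw [key ha ha', key hb hb', h]

/-- The set of primary components of `v`. -/
def primaryComponents (v : ℕ) : Finset ℕ :=
  v.primeFactors.image fun p => p ^ v.factorization p

theorem isPrimePow_of_mem_primaryComponents {v q : ℕ} (hq : q ∈ primaryComponents v) :
    IsPrimePow q := by
  obtain ⟨p, hp, rfl⟩ := Finset.mem_image.1 hq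
  have hp' := Nat.mem_primeFactors.1 hp
  exact hp'.1.isPrimePow.pow (hp'.1.factorization_pos_of_dvd hp'.2.2 hp'.2.1).ne'

theorem unitaryDvd_of_mem_primaryComponents {v q : ℕ} (hq : q ∈ primaryComponents v) :
    UnitaryDvd q v := by
  obtain ⟨p, hp, rfl⟩ := Finset.mem_image.1 hq
  have hp' := Nat.mem_primeFactors.1 hp
  exact ⟨v / p ^ v.factorization p, (Nat.coprime_ordCompl hp'.1 hp'.2.2).pow_left _,
    Nat.ordProj_mul_ordCompl_eq_self _ _⟩

theorem prod_primaryComponents {v : ℕ} (hv : v ≠ 0) : ∏ q ∈ primaryComponents v, q = v := by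
  rw [primaryComponents, Finset.prod_image]
  · exact Nat.prod_factorization_pow_eq_self hv
  · intro p hp p' hp' h
    have h1 := Nat.mem_primeFactors.1 hp
    have h2 := Nat.mem_primeFactors.1 hp'
    have h3 : p ∣ p' ^ v.factorization p' := by
      rw [← show p ^ v.factorization p = p' ^ v.factorization p' from h]
      exact dvd_pow_self p (h1.1.factorization_pos_of_dvd h1.2.2 h1.2.1).ne'
    exact (Nat.prime_dvd_prime_iff_eq h1.1 h2.1).1 (h1.1.dvd_of_dvd_pow h3)

theorem OrderIdeal.primaryComponents_subset (V : OrderIdeal) {v : ℕ} (hv : v ∈ V.carrier) :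
    (primaryComponents v : Set ℕ) ⊆ V.primePowers := fun q hq =>
  ⟨V.mem_of_unitaryDvd v hv q (unitaryDvd_of_mem_primaryComponents hq),
    isPrimePow_of_mem_primaryComponents hq⟩

theorem pairwise_coprime_of_injOn_minFac {σ : Finset ℕ} (hσ : ∀ q ∈ σ, IsPrimePow q)
    (hinj : Set.InjOn Nat.minFac (σ : Set ℕ)) : (σ : Set ℕ).Pairwise Nat.Coprime :=
  fun a ha b hb hab => coprime_of_minFac_ne (hσ a ha) (hσ b hb) fun h => hab (hinj ha hb h)

theorem prod_unitaryDvd_prod {σ τ : Finset ℕ} (hτσ : τ ⊆ σ)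
    (hc : (σ : Set ℕ).Pairwise Nat.Coprime) : UnitaryDvd (∏ q ∈ τ, q) (∏ q ∈ σ, q) := by
  classical
  refine ⟨∏ q ∈ σ \ τ, q, ?_, by rw [mul_comm, Finset.prod_sdiff hτσ]⟩
  refine Nat.Coprime.prod_left fun a ha => Nat.Coprime.prod_right fun b hb => ?_
  have hb' := Finset.mem_sdiff.1 hb
  exact hc (hτσ ha) hb'.1 fun h => hb'.2 (h ▸ ha)

/-- The generator has one full `p`-part for each prime, so distinct vertices are coprime, and a
product of coprime unitary divisors is again one. -/
theorem OrderIdeal.isSimplex_of_isPrincipal {V : OrderIdeal} (h : V.IsPrincipal) :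
    (complex V).IsSimplex := by
  obtain ⟨n, hn, hV⟩ := h
  have hud : ∀ v ∈ V.carrier, UnitaryDvd v n := fun v hv => by rwa [hV] at hv
  refine Set.Subset.antisymm (fun σ hσ => hσ.1) fun σ hσ => ?_
  have hinj : Set.InjOn Nat.minFac (σ : Set ℕ) := fun a ha b hb hab =>
    (hud a (hσ ha).1).eq_of_minFac_eq hn (hud b (hσ hb).1) (hσ ha).2 (hσ hb).2 hab
  refine ⟨hσ, hinj, ?_⟩
  rw [hV]
  exact UnitaryDvd.prod hn.ne' (fun q hq => hud q (hσ hq).1)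
    (pairwise_coprime_of_injOn_minFac (fun q hq => (hσ hq).2) hinj)

/-- The generator is the product of the whole vertex set, itself a face because `V` is finite. -/
theorem OrderIdeal.isPrincipal_of_isSimplex {V : OrderIdeal} (hfin : V.carrier.Finite)
    (h : (complex V).IsSimplex) : V.IsPrincipal := by
  have hP : V.primePowers.Finite := hfin.subset fun q hq => hq.1
  obtain ⟨-, hinj, hmem⟩ : hP.toFinset ∈ (complex V).faces := by
    rw [h]
    simp
  refine ⟨_, V.pos _ hmem, Set.Subset.antisymm (fun v hv => ?_)
    fun v hv => V.mem_of_unitaryDvd _ hmem v hv⟩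
  have hsub : primaryComponents v ⊆ hP.toFinset := fun q hq =>
    hP.mem_toFinset.2 (V.primaryComponents_subset hv hq)
  have := prod_unitaryDvd_prod hsub
    (pairwise_coprime_of_injOn_minFac (fun q hq => (hP.mem_toFinset.1 hq).2) hinj)
  rwa [prod_primaryComponents (V.pos v hv).ne'] at this

/-- In a finite order ideal in which only the greatest element `k` is maximal for unitary
divisibility, every element is a unitary divisor of `k`. -/
theorem OrderIdeal.carrier_eq_of_forall_exists {V : OrderIdeal} {k : ℕ}
    (hk : IsGreatest V.carrier k)
    (h : ∀ j ∈ V.carrier, j ≠ k → ∃ i, i ≠ 1 ∧ Nat.Coprime i j ∧ i * j ∈ V.carrier) :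
    V.carrier = {d | UnitaryDvd d k} := by
  refine Set.Subset.antisymm (fun v hv => ?_) fun v hv => V.mem_of_unitaryDvd k hk.1 v hv
  -- Multiplying `v` by its partner `i ≥ 2` stays in `V` and brings it closer to `k`.
  induction hd : k - v using Nat.strong_induction_on generalizing v with
  | _ d ih =>
    by_cases hvk : v = k
    · exact ⟨1, by simp, by simp [hvk]⟩
    · obtain ⟨i, hi, hc, hm⟩ := h v hv hvk
      have hi0 : 0 < i := Nat.pos_of_ne_zero fun h0 => (V.pos _ hm).ne' (by simp [h0])
      have hlt : v < i * v := by nlinarith [V.pos v hv, show 2 ≤ i by omega]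
      have hle := hk.2 hm
      exact UnitaryDvd.trans ⟨i, hc.symm, mul_comm _ _⟩ (ih (k - i * v) (by omega) _ hm rfl)

/-- The generator is `k` itself: `k` divides it, and it lies in `V`, hence is at most `k`. -/
theorem OrderIdeal.carrier_eq_of_isPrincipal {V : OrderIdeal} {k : ℕ}
    (hk : IsGreatest V.carrier k) (h : V.IsPrincipal) : V.carrier = {d | UnitaryDvd d k} := by
  obtain ⟨n, hn, hV⟩ := h
  have hnV : n ∈ V.carrier := by
    rw [hV]
    exact ⟨1, by simp, by simp⟩
  have hkn : UnitaryDvd k n := by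
    have := hk.1
    rwa [hV] at this
  rwa [le_antisymm (Nat.le_of_dvd hn hkn.dvd) (hk.2 hnV)]

end UnitaryConv

/-! ### The socle of the truncated algebra -/

namespace UnitaryConv

theorem conv_apply_one (f g : ℕ → ℂ) : conv f g 1 = f 1 * g 1 := by
  simp [conv, unitaryPairs, Finset.filter_singleton]

theorem conv_single_apply (f : ℕ → ℂ) {i j : ℕ} (hc : Nat.Coprime j i) (h0 : j * i ≠ 0) :
    conv f (Pi.single i 1) (j * i) = f j := by
  unfold conv
  rw [Finset.sum_eq_single (j, i)]
  · simp
  · rintro ⟨a, b⟩ hx hne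
    rw [mem_unitaryPairs] at hx
    have hb : b ≠ i := by
      rintro rfl
      exact hne (congrArg (·, b) (Nat.eq_of_mul_eq_mul_right
        (Nat.pos_of_ne_zero (right_ne_zero_of_mul h0)) hx.1.1))
    simp [hb]
  · exact fun h => absurd (mem_unitaryPairs.2 ⟨⟨rfl, h0⟩, hc⟩) h

namespace TruncAlgebra

open IsLocalRing

variable {V : OrderIdeal}

theorem toFun_e (k : ℕ) {n : ℕ} (hn : n ∈ V.carrier) :
    (e V k).toFun n = (Pi.single k 1 : ℕ → ℂ) n := toFun_trunc _ hn

theorem mul_e_apply (f : TruncAlgebra V) {i j : ℕ} (hc : Nat.Coprime j i)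
    (hm : j * i ∈ V.carrier) : (f * e V i).toFun (j * i) = f.toFun j := by
  rw [toFun_mul _ _ hm, conv_congr V (fun _ _ => rfl) (fun m hm => toFun_e i hm) hm,
    conv_single_apply _ hc (V.pos _ hm).ne']

theorem mem_maximalIdeal_iff (f : TruncAlgebra V) :
    f ∈ maximalIdeal (TruncAlgebra V) ↔ f.toFun 1 = 0 := by
  rw [IsLocalRing.mem_maximalIdeal, mem_nonunits_iff]
  refine ⟨fun h => by_contra fun h1 => h (isUnit_of_ne_zero f h1), fun h hu => ?_⟩
  obtain ⟨g, hg⟩ := hu.exists_right_inv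
  have h1 := toFun_one (V := V) V.one_mem
  rw [← hg, toFun_mul _ _ V.one_mem, conv_apply_one, h] at h1
  simp at h1

theorem e_mem_maximalIdeal {i : ℕ} (hi : i ≠ 1) : e V i ∈ maximalIdeal (TruncAlgebra V) := by
  rw [mem_maximalIdeal_iff, toFun_e i V.one_mem, Pi.single_eq_of_ne' hi]

theorem e_ne_zero {i : ℕ} (hi : i ∈ V.carrier) : e V i ≠ 0 := fun h => by
  have := toFun_e i hi
  rw [h, toFun_zero] at this
  simp at this

/-- Only the factorization with first factor `j` contributes to `e_j * g`; maximality of `j` makes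
the other factor `1`, where `g` vanishes. -/
theorem e_mem_socle {j : ℕ} (hj : j ≠ 1)
    (h : ∀ i, Nat.Coprime j i → j * i ∈ V.carrier → i = 1) : e V j ∈ socle (TruncAlgebra V) := by
  refine ⟨e_mem_maximalIdeal hj, fun g hg => ext fun n hn => ?_⟩
  rw [mem_maximalIdeal_iff] at hg
  rw [toFun_mul _ _ hn, conv_congr V (fun m hm => toFun_e j hm) (fun _ _ => rfl) hn, toFun_zero]
  refine Finset.sum_eq_zero fun x hx => ?_
  obtain ⟨⟨hx, -⟩, hc⟩ := mem_unitaryPairs.1 hx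
  by_cases hxj : x.1 = j
  · rw [h x.2 (hxj ▸ hc) (by rwa [← hxj, hx]), hg, mul_zero]
  · exact mul_eq_zero_of_left (Pi.single_eq_of_ne hxj 1) _

theorem e_mem_socle_of_isGreatest {k : ℕ} (hk1 : k ≠ 1) (hk : IsGreatest V.carrier k) :
    e V k ∈ socle (TruncAlgebra V) := by
  refine e_mem_socle hk1 fun i _ hi => ?_
  have h1 := hk.2 hi
  have h2 := V.pos _ hi
  have h3 := V.pos _ hk.1
  have h4 : i ≤ 1 := Nat.le_of_mul_le_mul_left (by rwa [mul_one]) h3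
  have h5 : 0 < i := Nat.pos_of_mul_pos_left h2
  omega

theorem span_e_le_socle {k : ℕ} (hk : e V k ∈ socle (TruncAlgebra V)) :
    Submodule.span ℂ {e V k} ≤ (socle (TruncAlgebra V)).restrictScalars ℂ :=
  (Submodule.span_singleton_le_iff_mem _ _).2 hk

/-- Subtracting the scalar `a.toFun 1` moves `a` into the maximal ideal, which kills `s`. This turns
ring multiples into `ℂ`-multiples. -/
theorem mul_eq_smul_of_mem_socle (a : TruncAlgebra V) {s : TruncAlgebra V}
    (hs : s ∈ socle (TruncAlgebra V)) : a * s = a.toFun 1 • s := by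
  have h : a - a.toFun 1 • 1 ∈ maximalIdeal (TruncAlgebra V) := by
    rw [mem_maximalIdeal_iff, sub_eq_add_neg, ← neg_smul, toFun_add, toFun_smul, Pi.add_apply,
      Pi.smul_apply, toFun_one V.one_mem]
    simp
  have := hs.2 _ h
  rwa [mul_sub, mul_smul_comm, mul_one, sub_eq_zero, mul_comm] at this

theorem finiteDimensional (hfin : V.carrier.Finite) : FiniteDimensional ℂ (TruncAlgebra V) := by
  have : Finite V.carrier := hfin
  let φ : TruncAlgebra V →ₗ[ℂ] (V.carrier → ℂ) :=
    { toFun := fun f n => f.toFun n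
      map_add' := fun _ _ => rfl
      map_smul' := fun _ _ => rfl }
  exact Module.Finite.of_injective φ fun f g h => ext fun n hn => congrFun h ⟨n, hn⟩

theorem isNilpotent_maximalIdeal (hfin : V.carrier.Finite) :
    IsNilpotent (maximalIdeal (TruncAlgebra V)) := by
  have := finiteDimensional hfin
  have : IsArtinianRing (TruncAlgebra V) := IsArtinianRing.of_finite ℂ _
  rw [← IsLocalRing.jacobson_eq_maximalIdeal ⊥ bot_ne_top]
  exact IsArtinianRing.isNilpotent_jacobson_bot

theorem socle_eq_span_of_isGorenstein (hfin : V.carrier.Finite) {k : ℕ} (hkV : k ∈ V.carrier)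
    (hk : e V k ∈ socle (TruncAlgebra V)) (h : IsGorensteinLocalRing (TruncAlgebra V)) :
    (socle (TruncAlgebra V)).restrictScalars ℂ = Submodule.span ℂ {e V k} := by
  refine le_antisymm (fun t ht => ?_) (span_e_le_socle hk)
  obtain ⟨n, hn⟩ := h.finite_injectiveDimension
  have := injective_of_hasInjectiveDimensionLT (e_ne_zero hkV)
    (fun a ha => by rw [mul_comm]; exact hk.2 a ha) (isNilpotent_maximalIdeal hfin)
    (ModuleCat.of (TruncAlgebra V) (TruncAlgebra V)) n
  obtain ⟨a, ha⟩ := exists_mul_eq_of_injective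
    (Module.injective_module_of_injective_object (TruncAlgebra V) (TruncAlgebra V))
    (e_ne_zero hkV) (fun a ha => by rw [mul_comm]; exact ht.2 a ha)
  exact Submodule.mem_span_singleton.2 ⟨a.toFun 1, by rw [ha, mul_eq_smul_of_mem_socle a hk]⟩

theorem isGorenstein_of_carrier_eq (hfin : V.carrier.Finite) {k : ℕ} (hkV : k ∈ V.carrier)
    (hV : V.carrier = {d | UnitaryDvd d k}) : IsGorensteinLocalRing (TruncAlgebra V) := by
  have := finiteDimensional hfin
  let φ : TruncAlgebra V →ₗ[ℂ] ℂ :=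
    { toFun := fun f => f.toFun k
      map_add' := fun _ _ => rfl
      map_smul' := fun _ _ => rfl }
  have : Module.Injective (TruncAlgebra V) (TruncAlgebra V) := by
    refine Module.Injective.self_of_linearForm φ fun f hf => ext fun n hn => ?_
    obtain ⟨m, hc, hm⟩ : UnitaryDvd n k := by rwa [hV] at hn
    -- With `n * m = k`, the value `f n` is the value of `f * e_m` at `k`, so the form `φ` detects
    -- every coefficient.
    rw [← mul_e_apply f hc (by rwa [hm]), hm, mul_comm]
    exact hf (e V m)
  have := Module.injective_object_of_injective_module (TruncAlgebra V) (TruncAlgebra V)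
  exact ⟨IsNoetherianRing.of_finite ℂ _, inferInstance, 1, inferInstance⟩

theorem exists_coprime_of_socle_eq_span {k : ℕ} (hk : IsGreatest V.carrier k)
    (h : (socle (TruncAlgebra V)).restrictScalars ℂ = Submodule.span ℂ {e V k}) :
    ∀ j ∈ V.carrier \ {k, 1}, ∃ i ∈ V.carrier \ {k, 1}, Nat.Coprime i j ∧ i * j ∈ V.carrier := by
  rintro j ⟨hj, hjk⟩
  simp only [Set.mem_insert_iff, Set.mem_singleton_iff, not_or] at hjk
  by_contra! hcon
  have hmem : e V j ∈ (socle (TruncAlgebra V)).restrictScalars ℂ := by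
    refine e_mem_socle hjk.2 fun i hc hi => by_contra fun hi1 => ?_
    refine hcon i ⟨V.right_mem hi hc, ?_⟩ hc.symm (by rwa [mul_comm])
    rintro (rfl | rfl)
    -- The partner cannot be `k`: `j ≥ 2` would give `j * k > k` in `V`.
    · have h1 := hk.2 hi
      have h2 := V.pos _ hk.1
      have h3 := V.pos _ hj
      nlinarith [show 2 ≤ j by omega]
    · exact hi1 rfl
  rw [h, Submodule.mem_span_singleton] at hmem
  obtain ⟨c, hc⟩ := hmem
  have h1 := toFun_e j hj
  rw [← hc, toFun_smul, Pi.smul_apply, toFun_e k hj, Pi.single_eq_of_ne hjk.1] at h1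
  simp at h1

end TruncAlgebra

end UnitaryConv

/-! ### The equivalences -/

theorem mainTheorem8 (V : UnitaryConv.OrderIdeal) (hfin : V.carrier.Finite)
    (hV : V.carrier.Nontrivial) (k : ℕ) (hk : IsGreatest V.carrier k) :
    UnitaryConv.TruncAlgebra.e V k ∈ UnitaryConv.socle (UnitaryConv.TruncAlgebra V) ∧
    List.TFAE [
      UnitaryConv.IsGorensteinLocalRing (UnitaryConv.TruncAlgebra V),
      (UnitaryConv.socle (UnitaryConv.TruncAlgebra V)).restrictScalars ℂ =
        Submodule.span ℂ {UnitaryConv.TruncAlgebra.e V k},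
      ∀ j ∈ V.carrier \ {k, 1}, ∃ i ∈ V.carrier \ {k, 1}, Nat.Coprime i j ∧ i * j ∈ V.carrier,
      V.IsPrincipal,
      (UnitaryConv.complex V).IsSimplex] := by
  open UnitaryConv TruncAlgebra in
  have hk1 : k ≠ 1 := by
    rintro rfl
    obtain ⟨m, hm, hm1⟩ := hV.exists_ne 1
    have h1 := hk.2 hm
    have h2 := V.pos m hm
    omega
  have hsoc := e_mem_socle_of_isGreatest hk1 hk
  refine ⟨hsoc, ?_⟩
  tfae_have 1 → 2 := socle_eq_span_of_isGorenstein hfin hk.1 hsoc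
  tfae_have 2 → 3 := exists_coprime_of_socle_eq_span hk
  tfae_have 3 → 4 := fun h => ⟨k, V.pos k hk.1,
    OrderIdeal.carrier_eq_of_forall_exists hk fun j hj hjk => by
      by_cases hj1 : j = 1
      -- Condition 3 says nothing about `j = 1`; there `k` serves as the partner.
      · exact ⟨k, hk1, by simp [hj1], by simpa [hj1] using hk.1⟩
      · obtain ⟨i, hi, hc, hm⟩ := h j ⟨hj, by simp [hjk, hj1]⟩
        exact ⟨i, fun h1 => hi.2 (by simp [h1]), hc, hm⟩⟩
  tfae_have 4 → 1 := fun h =>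
    isGorenstein_of_carrier_eq hfin hk.1 (OrderIdeal.carrier_eq_of_isPrincipal hk h)
  tfae_have 4 → 5 := OrderIdeal.isSimplex_of_isPrincipal
  tfae_have 5 → 4 := OrderIdeal.isPrincipal_of_isSimplex hfin
  tfae_finish
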